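/- Consider a parking lot with $K$ spaces, $K\in\{1,2,\dots\}\cup\{\infty\}$, and power level $M>0$ (a real number). Let $\lambda,\mu,\nu>0$. Let $Q(t)$ be the number of EVs present, $U(t)$ the number of those that are not fully charged, and $C(t)=Q(t)-U(t)$. EVs arrive at rate $\lambda$ (arrivals finding all $K$ spaces occupied are lost), parking times are exponential with rate $\mu$, charging requirements are exponential with rate $\nu$, and the total charging power is $\min\{U(t),M\}$. Thus $(U,Q)$ is the continuous-time Markov chain on $\{(u,q)\in\mathbb{Z}_{\ge 0}^2: u\le q\le K\}$ ($q<\infty$ when $K=\infty$) with jumps $$(u,q)\to(u+1,q+1)\ \text{at rate }\lambda\ (\text{if } q<K),\qquad (u,q)\to(u-1,q)\ \text{at rate }\nu\min\{u,M\},$$ $$(u,q)\to(u-1,q-1)\ \text{at rate }\mu u,\qquad (u,q)\to(u,q-1)\ \text{at rate }\mu(q-u).$$ A stationary distribution is a probability distribution $\pi$ on the state space that satisfies the global balance equations (total flow into each state equals total flow out of it). Proposition. Let $K$ be a positive integer and $0<M\le K$. Each of the systems $(\infty,M)$, $(K,M)$ and $(K,K)$ (spaces, power level), with the same $\lambda,\mu,\nu$,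 has a unique stationary distribution. Let $C^{\cdot}_{\cdot}(\infty)$ and $Q^{\cdot}_{\cdot}(\infty)$ denote the number of fully charged EVs and the total number of EVs in stationarity, where the superscript is the number of spaces and the subscript is the power level. All expectations below are finite, the denominators are positive, and $$\frac{\mathbb{E}[C^{\infty}_M(\infty)]}{\mathbb{E}[Q^{\infty}_M(\infty)]}\ \le\ \frac{\mathbb{E}[C^{K}_M(\infty)]}{\mathbb{E}[Q^{K}_M(\infty)]}\ \le\ \frac{\mathbb{E}[C^{K}_K(\infty)]}{\mathbb{E}[Q^{K}_M(\infty)]}.$$ -/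

import Mathlib

namespace ParkingLot

/-- States of the parking lot with `K` spaces (`K = ⊤` means infinitely many spaces): pairs
`(u, q)`, where `q` is the total number of EVs present, `u` is the number of EVs whose battery
is not fully charged, and `u ≤ q ≤ K`. -/
abbrev State (K : ℕ∞) : Type := {x : ℕ × ℕ // x.1 ≤ x.2 ∧ (x.2 : ℕ∞) ≤ K}

/-- Number of uncharged EVs. -/
def uncharged {K : ℕ∞} (x : State K) : ℝ := (x.1.1 : ℝ)

/-- Total number of EVs. -/
def total {K : ℕ∞} (x : State K) : ℝ := (x.1.2 : ℝ)

/-- Number of fully charged EVs. -/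
def charged {K : ℕ∞} (x : State K) : ℝ := total x - uncharged x

/-- Power consumed when `u` uncharged EVs are present and the power level is `M`. -/
noncomputable def power (M u : ℝ) : ℝ := min u M

/-- Rate of the jump `x → y` of the Markov process `(U(t), Q(t))`. With `x = (u, q)` the four
possible jumps, which have different targets, are:
an arrival to `(u + 1, q + 1)`; a completed charge, to `(u - 1, q)`;
a departure of an uncharged EV, to `(u - 1, q - 1)`;
a departure of a charged EV, to `(u, q - 1)`.
Since `y` ranges over `State K` only, there is no arrival jump when all `K` spaces are taken. -/
noncomputable def rate (lam mu nu M : ℝ) {K : ℕ∞} (x y : State K) : ℝ :=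
  (if y.1.1 = x.1.1 + 1 ∧ y.1.2 = x.1.2 + 1 then lam else 0) +
  (if y.1.1 + 1 = x.1.1 ∧ y.1.2 = x.1.2 then nu * power M (uncharged x) else 0) +
  (if y.1.1 + 1 = x.1.1 ∧ y.1.2 + 1 = x.1.2 then mu * uncharged x else 0) +
  (if y.1.1 = x.1.1 ∧ y.1.2 + 1 = x.1.2 then mu * charged x else 0)

/-- `p` is a stationary distribution of the system `(K, M)`: a probability distribution on the
state space with `p Q = 0` for the generator matrix `Q` of the process, that is, the total flow
into each state equals the total flow out of it. (Each of the two sums in `balance` has at most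
four nonzero terms.) -/
structure IsStationary (lam mu nu M : ℝ) (K : ℕ∞) (p : State K → ℝ) : Prop where
  nonneg : ∀ x, 0 ≤ p x
  hasSum_one : HasSum p 1
  balance : ∀ y, ∑' x, p x * rate lam mu nu M x y = p y * ∑' z, rate lam mu nu M y z

/-- Expectation of `f` under the distribution `p`. -/
noncomputable def expectation {K : ℕ∞} (p : State K → ℝ) (f : State K → ℝ) : ℝ :=
  ∑' x, p x * f x

end ParkingLot

/-! In stationarity EVs become charged as fast as charged EVs leave, so `mu * E[C] = nu * E[min(U,
M)]`. As `E[Q] = E[U] + E[C]`, the ratio `E[C] / E[Q]` increases with `E[min(U, M)] / E[U]`, and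
both inequalities become statements about `U` and `Q` separately.

First inequality: balancing the flow between `U ≤ n` and `U > n` gives `d n * P(U = n + 1) = lam *
P(U = n, Q < K)`, where `d n` depends on neither `K` nor `Q`. Dropping the blocking event gives `≤`,
with equality for infinitely many spaces. Hence `U` for `K` spaces is below `U` for infinitely many
in the likelihood ratio order (`likelihood_ratio_of_rates`). Since `min(u, M) / u` is nonincreasing,
symmetrizing a double sum compares the ratios of means (`tsum_mul_tsum_le_of_likelihood_ratio`).

Second inequality: `Q` is truncated Poisson whatever the power level, so `E[Q]` agrees for `M` and
`K`. From `min(U, M) ≤ U` follows `(mu + nu) * E[C] ≤ nu * E[Q]`, with equality at power level `K`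
because `U ≤ K`.

The Poisson bound on stationary weights is uniform in `K` and `M`. It supplies all integrability,
the uniqueness for the unbounded chain, and the tightness that makes finite lots converge to the
infinite one. -/

namespace ParkingLot

/-! ### General Markov chains with locally finite rates -/

section Chain

variable {S : Type*} {r : S → S → ℝ}

/-- Total flow into `y` and out of `y` agree for every state `y`. -/
def Balanced (r : S → S → ℝ) (p : S → ℝ) : Prop :=
  ∀ y, ∑' x, p x * r x y = p y * ∑' z, r y z

/-- Nonnegative jump rates with finitely many jumps out of and into each state. -/
structure LocallyFiniteRates (r : S → S → ℝ) : Prop where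
  nonneg : ∀ x y, 0 ≤ r x y
  row : ∀ x, (Function.support (r x)).Finite
  col : ∀ y, (Function.support (fun x => r x y)).Finite

namespace LocallyFiniteRates

theorem summable_row (hr : LocallyFiniteRates r) (x : S) : Summable (r x) :=
  summable_of_hasFiniteSupport (hr.row x)

theorem summable_col (hr : LocallyFiniteRates r) (w : S → ℝ) (y : S) :
    Summable (fun x => w x * r x y) := by
  refine summable_of_hasFiniteSupport ((hr.col y).subset fun x hx => ?_)
  simp only [Function.mem_support] at hx ⊢
  exact right_ne_zero_of_mul hx

theorem exit_nonneg (hr : LocallyFiniteRates r) (x : S) : 0 ≤ ∑' z, r x z :=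
  tsum_nonneg (hr.nonneg x)

theorem summable_flow (hr : LocallyFiniteRates r) {w : S → ℝ} (hw : ∀ x, 0 ≤ w x)
    (hs : Summable fun x => w x * ∑' z, r x z) :
    Summable fun z : S × S => w z.1 * r z.1 z.2 := by
  refine (summable_prod_of_nonneg fun z => mul_nonneg (hw _) (hr.nonneg _ _)).2
    ⟨fun x => (hr.summable_row x).mul_left (w x), ?_⟩
  simpa only [tsum_mul_left] using hs

/-- Fubini on the double sum of flows. Since total inflow equals total outflow, a one-sided balance
inequality at every state must be an equality, as the next two lemmas exploit. -/
theorem hasSum_inflow (hr : LocallyFiniteRates r) {w : S → ℝ} (hw : ∀ x, 0 ≤ w x)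
    (hs : Summable fun x => w x * ∑' z, r x z) :
    HasSum (fun y => ∑' x, w x * r x y) (∑' x, w x * ∑' z, r x z) := by
  have h := hr.summable_flow hw hs
  have h1 : HasSum (fun x => w x * ∑' z, r x z) (∑' z : S × S, w z.1 * r z.1 z.2) :=
    h.hasSum.prod_fiberwise fun x => ((hr.summable_row x).hasSum.mul_left (w x))
  have h2 : HasSum (fun z : S × S => w z.2 * r z.2 z.1) (∑' z : S × S, w z.1 * r z.1 z.2) :=
    (Equiv.prodComm S S).hasSum_iff (f := fun z : S × S => w z.1 * r z.1 z.2) |>.2 h.hasSum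
  rw [h1.tsum_eq]
  exact h2.prod_fiberwise fun y => (hr.summable_col w y).hasSum

theorem balanced_of_inflow_le (hr : LocallyFiniteRates r) {w : S → ℝ} (hw : ∀ x, 0 ≤ w x)
    (hs : Summable fun x => w x * ∑' z, r x z)
    (h : ∀ y, ∑' x, w x * r x y ≤ w y * ∑' z, r y z) : Balanced r w := by
  have h0 := hs.hasSum.sub (hr.hasSum_inflow hw hs)
  rw [sub_self, hasSum_zero_iff_of_nonneg fun y => sub_nonneg.2 (h y)] at h0
  exact fun y => (sub_eq_zero.1 (congrFun h0 y)).symm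

theorem balanced_of_le_inflow (hr : LocallyFiniteRates r) {w : S → ℝ} (hw : ∀ x, 0 ≤ w x)
    (hs : Summable fun x => w x * ∑' z, r x z)
    (h : ∀ y, w y * ∑' z, r y z ≤ ∑' x, w x * r x y) : Balanced r w := by
  have h0 := (hr.hasSum_inflow hw hs).sub hs.hasSum
  rw [sub_self, hasSum_zero_iff_of_nonneg fun y => sub_nonneg.2 (h y)] at h0
  exact fun y => sub_eq_zero.1 (congrFun h0 y)

/-- The generator applied to `f` has mean zero under a balanced measure. -/
theorem hasSum_generator (hr : LocallyFiniteRates r) {p : S → ℝ} (hp : ∀ x, 0 ≤ p x)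
    (hb : Balanced r p) (f : S → ℝ) (hs : Summable fun x => p x * (∑' z, r x z) * |f x|) :
    HasSum (fun x => p x * ∑' y, r x y * (f y - f x)) 0 := by
  have hF : Summable fun z : S × S => p z.1 * r z.1 z.2 * f z.1 := by
    refine Summable.of_norm ((summable_prod_of_nonneg fun z => norm_nonneg _).2 ⟨fun x => ?_, ?_⟩)
    · exact (((hr.summable_row x).mul_left (p x)).mul_right (f x)).norm
    · refine hs.congr fun x => ?_
      simp_rw [norm_mul, Real.norm_eq_abs, abs_of_nonneg (hp _), abs_of_nonneg (hr.nonneg _ _)]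
      rw [tsum_mul_right, tsum_mul_left]
  -- Balance turns the inflow into `y` into the outflow from `y`, so the same hypothesis `hs`
  -- controls this sum.
  have hG : Summable fun z : S × S => p z.2 * r z.2 z.1 * f z.1 := by
    refine Summable.of_norm ((summable_prod_of_nonneg fun z => norm_nonneg _).2 ⟨fun y => ?_, ?_⟩)
    · exact ((hr.summable_col p y).mul_right (f y)).norm
    · refine hs.congr fun y => ?_
      simp_rw [norm_mul, Real.norm_eq_abs, abs_of_nonneg (hp _), abs_of_nonneg (hr.nonneg _ _)]
      rw [tsum_mul_right, hb y]
  have hF' : HasSum (fun x => p x * (∑' z, r x z) * f x)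
      (∑' z : S × S, p z.1 * r z.1 z.2 * f z.1) :=
    hF.hasSum.prod_fiberwise fun x => ((hr.summable_row x).hasSum.mul_left (p x)).mul_right (f x)
  have hG' : HasSum (fun y => (∑' x, p x * r x y) * f y)
      (∑' z : S × S, p z.2 * r z.2 z.1 * f z.1) :=
    hG.hasSum.prod_fiberwise fun y => (hr.summable_col p y).hasSum.mul_right (f y)
  have he : ∑' z : S × S, p z.2 * r z.2 z.1 * f z.1 = ∑' z : S × S, p z.1 * r z.1 z.2 * f z.1 := by
    simp only [hb _] at hG'
    exact hG'.unique hF'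
  have hG2 : HasSum (fun z : S × S => p z.1 * r z.1 z.2 * f z.2)
      (∑' z : S × S, p z.2 * r z.2 z.1 * f z.1) :=
    (Equiv.prodComm S S).hasSum_iff (f := fun z : S × S => p z.2 * r z.2 z.1 * f z.1)
      |>.2 hG.hasSum
  have hd := hG2.sub hF.hasSum
  rw [he, sub_self] at hd
  refine hd.prod_fiberwise fun x => ?_
  have hx := (hd.summable.prod_factor x).hasSum
  have hcongr : ∀ y, p x * r x y * f y - p x * r x y * f x = p x * (r x y * (f y - f x)) :=
    fun y => by ring
  simp only [hcongr, tsum_mul_left] at hx ⊢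
  exact hx

/-- Zero mass at a state forces zero inflow there; the inflow terms are nonnegative, so every direct
predecessor has zero mass too. -/
theorem eq_zero_of_reaches (hr : LocallyFiniteRates r) {p : S → ℝ} (hp : ∀ x, 0 ≤ p x)
    (hb : Balanced r p) {x y : S} (h : Relation.ReflTransGen (fun a b => 0 < r a b) x y)
    (hy : p y = 0) : p x = 0 := by
  induction h with
  | refl => exact hy
  | @tail b c _ hbc ih =>
    apply ih
    have h0 := hb c
    rw [hy, zero_mul] at h0
    have h1 := (hr.summable_col p c).hasSum
    rw [h0, hasSum_zero_iff_of_nonneg fun x => mul_nonneg (hp x) (hr.nonneg _ _)] at h1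
    exact (mul_eq_zero.1 (congrFun h1 b)).resolve_right hbc.ne'

theorem Balanced.sub (hr : LocallyFiniteRates r) {p w : S → ℝ}
    (hp : Balanced r p) (hw : Balanced r w) : Balanced r (fun x => p x - w x) := fun y => by
  simp only [sub_mul]
  rw [(hr.summable_col p y).tsum_sub (hr.summable_col w y), hp y, hw y]

/-- An irreducible chain has at most one stationary distribution with finite mean exit rate. -/
theorem stationary_unique (hr : LocallyFiniteRates r)
    (hirr : ∀ x y, Relation.ReflTransGen (fun a b => 0 < r a b) x y)
    {p w : S → ℝ} (hp : ∀ x, 0 ≤ p x) (hw : ∀ x, 0 ≤ w x) (hp1 : HasSum p 1) (hw1 : HasSum w 1)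
    (hbp : Balanced r p) (hbw : Balanced r w) (hs : Summable fun x => p x * ∑' z, r x z) :
    p = w := by
  set m : S → ℝ := fun x => min (p x) (w x) with hm
  have hm0 : ∀ x, 0 ≤ m x := fun x => le_min (hp x) (hw x)
  have hms : Summable fun x => m x * ∑' z, r x z :=
    hs.of_nonneg_of_le (fun x => mul_nonneg (hm0 x) (hr.exit_nonneg x))
      fun x => mul_le_mul_of_nonneg_right (min_le_left _ _) (hr.exit_nonneg x)
  -- At each `y` the minimum equals `p y` or `w y`; balance of that one bounds the inflow of the
  -- minimum by its outflow.
  have hbm : Balanced r m := by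
    refine hr.balanced_of_inflow_le hm0 hms fun y => ?_
    rcases min_choice (p y) (w y) with h | h
    · simp only [hm, h]
      rw [← hbp y]
      exact (hr.summable_col m y).tsum_le_tsum
        (fun x => mul_le_mul_of_nonneg_right (min_le_left _ _) (hr.nonneg _ _))
        (hr.summable_col p y)
    · simp only [hm, h]
      rw [← hbw y]
      exact (hr.summable_col m y).tsum_le_tsum
        (fun x => mul_le_mul_of_nonneg_right (min_le_right _ _) (hr.nonneg _ _))
        (hr.summable_col w y)
  have key : ∀ {a b : S → ℝ}, HasSum a 1 → HasSum b 1 → (∀ x, a x ≤ b x) → a = b := by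
    intro a b ha hb hab
    have h := hb.sub ha
    rw [sub_self, hasSum_zero_iff_of_nonneg fun y => sub_nonneg.2 (hab y)] at h
    exact funext fun y => (sub_eq_zero.1 (congrFun h y)).symm
  by_cases hle : ∀ x, p x ≤ w x
  · exact key hp1 hw1 hle
  · push Not at hle
    obtain ⟨x₀, hx₀⟩ := hle
    refine (key hw1 hp1 fun x => ?_).symm
    -- The balanced nonnegative measure `w - m` vanishes at `x₀`, hence everywhere by
    -- irreducibility, so `w ≤ p`; equal total mass then forces equality.
    have h0 := hr.eq_zero_of_reaches (p := fun x => w x - m x)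
      (fun x => sub_nonneg.2 (min_le_right _ _)) (Balanced.sub hr hbw hbm) (hirr x x₀)
      (by simp [hm, min_eq_right hx₀.le])
    have : w x = min (p x) (w x) := by simpa [hm, sub_eq_zero] using h0
    rw [this]
    exact min_le_left _ _

/-- A finite chain has a stationary distribution. -/
theorem exists_stationary [Fintype S] [Nonempty S] (hr : LocallyFiniteRates r) :
    ∃ p : S → ℝ, (∀ x, 0 ≤ p x) ∧ HasSum p 1 ∧ Balanced r p := by
  classical
  -- The generator matrix: its rows sum to zero, so it is singular and has a nonzero left null
  -- vector, of unknown sign.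
  let A : Matrix S S ℝ := Matrix.of fun x y => r x y - if x = y then ∑ z, r x z else 0
  have hdet : A.det = 0 := by
    refine Matrix.exists_mulVec_eq_zero_iff.1 ⟨fun _ => 1, ?_, ?_⟩
    · exact fun h => one_ne_zero (congrFun h (Classical.arbitrary S))
    · ext x
      simp [A, Matrix.mulVec, dotProduct]
  obtain ⟨v, hv0, hv⟩ := Matrix.exists_vecMul_eq_zero_iff.2 hdet
  have hv' : ∀ y, ∑ x, v x * r x y = v y * ∑ z, r y z := fun y => by
    have h := congrFun hv y
    simp only [A, Matrix.vecMul, dotProduct, Matrix.of_apply, mul_sub, Finset.sum_sub_distrib,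
      mul_ite, mul_zero, Finset.sum_ite_eq', Finset.mem_univ, if_true, Pi.zero_apply] at h
    exact sub_eq_zero.1 h
  -- By the triangle inequality the outflow of `|v|` is at most its inflow, which already implies
  -- balance.
  have hb : Balanced r fun x => |v x| := by
    refine hr.balanced_of_le_inflow (fun x => abs_nonneg _) (Summable.of_finite) fun y => ?_
    rw [tsum_fintype, tsum_fintype,
      ← abs_of_nonneg (Finset.sum_nonneg fun z _ => hr.nonneg y z), ← abs_mul, ← hv' y]
    refine (Finset.abs_sum_le_sum_abs _ _).trans (Finset.sum_le_sum fun x _ => ?_)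
    rw [abs_mul, abs_of_nonneg (hr.nonneg x y)]
  have hpos : 0 < ∑ x, |v x| := by
    obtain ⟨x, hx⟩ := Function.ne_iff.1 hv0
    exact Finset.sum_pos' (fun x _ => abs_nonneg _) ⟨x, Finset.mem_univ x, abs_pos.2 hx⟩
  refine ⟨fun x => |v x| / ∑ x, |v x|, fun x => div_nonneg (abs_nonneg _) hpos.le, ?_, fun y => ?_⟩
  · have h := hasSum_fintype fun x => |v x| / ∑ x, |v x|
    rwa [← Finset.sum_div, div_self hpos.ne'] at h
  · simp only [div_mul_eq_mul_div, tsum_div_const]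
    rw [hb y]

end LocallyFiniteRates

end Chain

/-! ### The jump rates, the generator and irreducibility -/

section Rates

variable {lam mu nu M : ℝ} {K : ℕ∞}

theorem uncharged_nonneg (x : State K) : 0 ≤ uncharged x := Nat.cast_nonneg _

theorem total_nonneg (x : State K) : 0 ≤ total x := Nat.cast_nonneg _

theorem charged_nonneg (x : State K) : 0 ≤ charged x :=
  sub_nonneg.2 (Nat.cast_le.2 x.2.1)

theorem power_nonneg (hM : 0 < M) {u : ℝ} (hu : 0 ≤ u) : 0 ≤ power M u := le_min hu hM.le

theorem power_zero (hM : 0 < M) : power M 0 = 0 := min_eq_left hM.le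

theorem rate_nonneg (hlam : 0 < lam) (hmu : 0 < mu) (hnu : 0 < nu) (hM : 0 < M)
    (x y : State K) : 0 ≤ rate lam mu nu M x y := by
  have h1 := mul_nonneg hnu.le (power_nonneg hM (uncharged_nonneg x))
  have h2 := mul_nonneg hmu.le (uncharged_nonneg x)
  have h3 := mul_nonneg hmu.le (charged_nonneg x)
  unfold rate
  split_ifs <;> linarith

theorem rate_ne_zero_cases {x y : State K} (h : rate lam mu nu M x y ≠ 0) :
    (y.1.1 = x.1.1 + 1 ∧ y.1.2 = x.1.2 + 1) ∨ (y.1.1 + 1 = x.1.1 ∧ y.1.2 = x.1.2) ∨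
    (y.1.1 + 1 = x.1.1 ∧ y.1.2 + 1 = x.1.2) ∨ (y.1.1 = x.1.1 ∧ y.1.2 + 1 = x.1.2) := by
  contrapose! h
  unfold rate
  rw [if_neg (by tauto), if_neg (by tauto), if_neg (by tauto), if_neg (by tauto)]
  simp

theorem finite_total_le (K : ℕ∞) (n : ℕ) : {x : State K | x.1.2 ≤ n}.Finite := by
  refine Set.Finite.of_finite_image (f := Subtype.val)
    ((Set.finite_Iic (n, n)).subset ?_) Subtype.val_injective.injOn
  rintro _ ⟨x, hx, rfl⟩
  exact ⟨x.2.1.trans hx, hx⟩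

theorem locallyFiniteRates (hlam : 0 < lam) (hmu : 0 < mu) (hnu : 0 < nu) (hM : 0 < M) :
    LocallyFiniteRates (rate lam mu nu M (K := K)) where
  nonneg := rate_nonneg hlam hmu hnu hM
  row x := (finite_total_le K (x.1.2 + 1)).subset fun y hy => by
    have := rate_ne_zero_cases hy
    simp only [Set.mem_ofPred_eq]
    omega
  col y := (finite_total_le K (y.1.2 + 1)).subset fun x hx => by
    have := rate_ne_zero_cases hx
    simp only [Set.mem_ofPred_eq]
    omega

theorem hasSum_ite_state (a b : ℕ) (c : ℝ) (h : ℕ → ℕ → ℝ) :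
    HasSum (fun y : State K => (if y.1.1 = a ∧ y.1.2 = b then c else 0) * h y.1.1 y.1.2)
      (if a ≤ b ∧ (b : ℕ∞) ≤ K then c * h a b else 0) := by
  split_ifs with hab
  · have := hasSum_single (f := fun y : State K =>
      (if y.1.1 = a ∧ y.1.2 = b then c else 0) * h y.1.1 y.1.2) ⟨(a, b), hab⟩ fun y hy => by
        rw [if_neg, zero_mul]
        rintro ⟨rfl, rfl⟩
        exact hy rfl
    simpa using this
  · convert hasSum_zero with y
    rw [if_neg, zero_mul]
    rintro ⟨rfl, rfl⟩
    exact hab y.2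

/-- Sums over the jumps out of a state. -/
theorem hasSum_rate_mul (hM : 0 < M) (x : State K) (h : ℕ → ℕ → ℝ) :
    HasSum (fun y : State K => rate lam mu nu M x y * h y.1.1 y.1.2)
      ((if ((x.1.2 + 1 : ℕ) : ℕ∞) ≤ K then lam * h (x.1.1 + 1) (x.1.2 + 1) else 0) +
        nu * power M (uncharged x) * h (x.1.1 - 1) x.1.2 +
        mu * uncharged x * h (x.1.1 - 1) (x.1.2 - 1) +
        mu * charged x * h x.1.1 (x.1.2 - 1)) := by
  obtain ⟨⟨u, q⟩, huq, hqK⟩ := x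
  simp only at huq hqK
  have hle : ((q - 1 : ℕ) : ℕ∞) ≤ K := (Nat.cast_le.2 (Nat.sub_le q 1)).trans hqK
  simp only [rate, uncharged, charged, total, add_mul]
  refine (((?_ : HasSum _ _).add (?_ : HasSum _ _)).add (?_ : HasSum _ _)).add (?_ : HasSum _ _)
  · simpa [huq] using hasSum_ite_state (K := K) (u + 1) (q + 1) lam h
  -- At `u = 0` the truncated `u - 1` is a wrong target, but the jump has rate zero there.
  · rcases Nat.eq_zero_or_pos u with rfl | hu
    · simp [power_zero hM, hasSum_zero]
    · have h1 := hasSum_ite_state (K := K) (u - 1) q (nu * power M u) h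
      rw [if_pos ⟨by omega, hqK⟩] at h1
      refine h1.congr_fun fun y => ?_
      congr 2
      apply propext; omega
  · rcases Nat.eq_zero_or_pos u with rfl | hu
    · simp [hasSum_zero]
    · have h1 := hasSum_ite_state (K := K) (u - 1) (q - 1) (mu * u) h
      rw [if_pos ⟨by omega, hle⟩] at h1
      refine h1.congr_fun fun y => ?_
      congr 2
      apply propext; omega
  · rcases huq.eq_or_lt with rfl | hu
    · simp [hasSum_zero]
    · have h1 := hasSum_ite_state (K := K) u (q - 1) (mu * (q - u)) h
      rw [if_pos ⟨by omega, hle⟩] at h1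
      refine h1.congr_fun fun y => ?_
      congr 2
      apply propext; omega

theorem exit_rate (hM : 0 < M) (x : State K) :
    ∑' z, rate lam mu nu M x z =
      (if ((x.1.2 + 1 : ℕ) : ℕ∞) ≤ K then lam else 0) + nu * power M (uncharged x) +
        mu * total x := by
  have h := (hasSum_rate_mul (lam := lam) (mu := mu) (nu := nu) hM x fun _ _ => 1).tsum_eq
  simp only [mul_one] at h
  rw [h, charged]
  ring

theorem exit_rate_le (hlam : 0 < lam) (hmu : 0 < mu) (hnu : 0 < nu) (hM : 0 < M) (x : State K) :
    ∑' z, rate lam mu nu M x z ≤ (lam + nu * M + mu) * (1 + total x) := by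
  rw [exit_rate hM]
  have h1 : (if ((x.1.2 + 1 : ℕ) : ℕ∞) ≤ K then lam else 0) ≤ lam := by split_ifs <;> linarith
  have h2 : nu * power M (uncharged x) ≤ nu * M :=
    mul_le_mul_of_nonneg_left (min_le_right _ _) hnu.le
  nlinarith [total_nonneg x, mul_pos hnu hM, mul_nonneg hlam.le (total_nonneg x),
    mul_nonneg (mul_pos hnu hM).le (total_nonneg x)]

/-- The generator of the process applied to `h`. -/
noncomputable def generator (lam mu nu M : ℝ) {K : ℕ∞} (h : ℕ → ℕ → ℝ) (x : State K) : ℝ :=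
  (if ((x.1.2 + 1 : ℕ) : ℕ∞) ≤ K then lam * (h (x.1.1 + 1) (x.1.2 + 1) - h x.1.1 x.1.2) else 0) +
    nu * power M (uncharged x) * (h (x.1.1 - 1) x.1.2 - h x.1.1 x.1.2) +
    mu * uncharged x * (h (x.1.1 - 1) (x.1.2 - 1) - h x.1.1 x.1.2) +
    mu * charged x * (h x.1.1 (x.1.2 - 1) - h x.1.1 x.1.2)

/-- Empty the lot by departures, fill it with uncharged EVs up to the target total, then charge as
many as needed. -/
theorem reaches (hlam : 0 < lam) (hmu : 0 < mu) (hnu : 0 < nu) (hM : 0 < M) (x y : State K) :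
    Relation.ReflTransGen (fun a b : State K => 0 < rate lam mu nu M a b) x y := by
  have pos : ∀ {a b : State K}, rate lam mu nu M a b ≠ 0 → 0 < rate lam mu nu M a b :=
    fun h => (rate_nonneg hlam hmu hnu hM _ _).lt_of_ne' h
  have h0K : (0 : ℕ) ≤ 0 ∧ ((0 : ℕ) : ℕ∞) ≤ K := ⟨le_rfl, by simp⟩
  have down : ∀ (q u : ℕ) (h : u ≤ q ∧ (q : ℕ∞) ≤ K),
      Relation.ReflTransGen (fun a b : State K => 0 < rate lam mu nu M a b)
        ⟨(u, q), h⟩ ⟨(0, 0), h0K⟩ := by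
    intro q
    induction q with
    | zero =>
      intro u h
      obtain rfl : u = 0 := by omega
      exact .refl
    | succ q ih =>
      intro u h
      have hq : ((q : ℕ) : ℕ∞) ≤ K := (Nat.cast_le.2 (Nat.le_succ q)).trans h.2
      rcases Nat.eq_zero_or_pos u with rfl | hu
      · refine .head (pos ?_) (ih 0 ⟨by omega, hq⟩)
        have : (0 : ℝ) < mu * (q + 1) := by positivity
        simpa [rate, charged, total, uncharged] using this.ne'
      · refine .head (pos ?_) (ih (u - 1) ⟨by omega, hq⟩)
        have : (0 : ℝ) < mu * u := by positivity
        have h1 : u - 1 ≠ u + 1 := by omega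
        have h2 : u - 1 + 1 = u := by omega
        have h3 : u - 1 ≠ u := by omega
        simpa [rate, charged, total, uncharged, h1, h2, h3] using this.ne'
  have up : ∀ (q : ℕ) (h : q ≤ q ∧ (q : ℕ∞) ≤ K),
      Relation.ReflTransGen (fun a b : State K => 0 < rate lam mu nu M a b)
        ⟨(0, 0), h0K⟩ ⟨(q, q), h⟩ := by
    intro q
    induction q with
    | zero => exact fun _ => .refl
    | succ q ih =>
      intro h
      have hq : ((q : ℕ) : ℕ∞) ≤ K := (Nat.cast_le.2 (Nat.le_succ q)).trans h.2
      refine .tail (ih ⟨le_rfl, hq⟩) (pos ?_)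
      simpa [rate, charged, total, uncharged, show q + 1 + 1 ≠ q by omega] using hlam.ne'
  have left : ∀ (q k u : ℕ) (h : u ≤ q ∧ (q : ℕ∞) ≤ K), u + k = q →
      Relation.ReflTransGen (fun a b : State K => 0 < rate lam mu nu M a b)
        ⟨(0, 0), h0K⟩ ⟨(u, q), h⟩ := by
    intro q k
    induction k with
    | zero =>
      rintro u h rfl
      exact up u h
    | succ k ih =>
      intro u h hk
      refine .tail (ih (u + 1) ⟨by omega, h.2⟩ (by omega)) (pos ?_)
      have h1 : (0 : ℝ) < nu * power M (u + 1) := mul_pos hnu (lt_min (by positivity) hM)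
      simpa [rate, charged, total, uncharged] using h1.ne'
  exact (down _ _ x.2).trans (left _ (y.1.2 - y.1.1) _ y.2 (by have := y.2.1; omega))

theorem IsStationary.balanced {p : State K → ℝ} (h : IsStationary lam mu nu M K p) :
    Balanced (rate lam mu nu M (K := K)) p := h.balance

/-- The generator has mean zero in stationarity. -/
theorem IsStationary.hasSum_generator (hlam : 0 < lam) (hmu : 0 < mu) (hnu : 0 < nu) (hM : 0 < M)
    {p : State K → ℝ} (h : IsStationary lam mu nu M K p) (f : ℕ → ℕ → ℝ)
    (hs : Summable fun x : State K => p x * (1 + total x) * |f x.1.1 x.1.2|) :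
    HasSum (fun x => p x * generator lam mu nu M f x) 0 := by
  have hr := locallyFiniteRates (K := K) hlam hmu hnu hM
  have h1 := hr.hasSum_generator h.nonneg h.balanced (fun x => f x.1.1 x.1.2) ?_
  · refine h1.congr_fun fun x => ?_
    rw [(hasSum_rate_mul hM x fun a b => f a b - f x.1.1 x.1.2).tsum_eq, generator]
  · refine (hs.mul_left (lam + nu * M + mu)).of_nonneg_of_le (fun x => ?_) fun x => ?_
    · exact mul_nonneg (mul_nonneg (h.nonneg x) (hr.exit_nonneg x)) (abs_nonneg _)
    · rw [mul_comm (p x), mul_comm (p x), ← mul_assoc, ← mul_assoc]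
      exact mul_le_mul_of_nonneg_right (mul_le_mul_of_nonneg_right
        (exit_rate_le hlam hmu hnu hM x) (h.nonneg x)) (abs_nonneg _)

end Rates

/-! ### Marginal laws, the Poisson bound and uniqueness -/

section Marginals

variable {lam mu nu M : ℝ} {K : ℕ∞}

/-- Summation along the fibers of a map. -/
theorem hasSum_fibers {S : Type*} (φ : S → ℕ) {F : S → ℝ} {T : ℝ} (hF : HasSum F T) :
    HasSum (fun n => ∑' x, F x * if φ x = n then 1 else 0) T := by
  have hi : Function.Injective fun x : S => (φ x, x) := fun x y h => congrArg Prod.snd h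
  have h : HasSum (fun z : ℕ × S => F z.2 * if φ z.2 = z.1 then 1 else 0) T := by
    refine (hi.hasSum_iff (f := fun z : ℕ × S => F z.2 * if φ z.2 = z.1 then 1 else 0) ?_).1 ?_
    · rintro ⟨n, x⟩ hx
      have : φ x ≠ n := fun h => hx ⟨x, by simp [h]⟩
      simp [this]
    · simpa [Function.comp_def] using hF
  exact h.prod_fiberwise fun n => (h.summable.prod_factor n).hasSum

/-- The distribution of the integer quantity `φ` under `p`. -/
noncomputable def marginal {S : Type*} (p : S → ℝ) (φ : S → ℕ) (n : ℕ) : ℝ :=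
  ∑' x, p x * if φ x = n then 1 else 0

theorem marginal_nonneg {S : Type*} {p : S → ℝ} (hp : ∀ x, 0 ≤ p x) (φ : S → ℕ) (n : ℕ) :
    0 ≤ marginal p φ n :=
  tsum_nonneg fun x => mul_nonneg (hp x) (by split_ifs <;> norm_num)

theorem hasSum_marginal_mul {S : Type*} {p : S → ℝ} (φ : S → ℕ) (g : ℕ → ℝ)
    (hs : Summable fun x => p x * g (φ x)) :
    HasSum (fun n => marginal p φ n * g n) (∑' x, p x * g (φ x)) := by
  refine (hasSum_fibers φ hs.hasSum).congr_fun fun n => ?_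
  rw [marginal, ← tsum_mul_right]
  refine tsum_congr fun x => ?_
  split_ifs with h
  · rw [h]; ring
  · ring

theorem summable_indicator {S : Type*} {p : S → ℝ} (hp : Summable p) (hp0 : ∀ x, 0 ≤ p x)
    (P : S → Prop) [DecidablePred P] : Summable fun x => p x * if P x then 1 else 0 :=
  hp.of_nonneg_of_le (fun x => mul_nonneg (hp0 x) (by split_ifs <;> norm_num))
    fun x => by split_ifs <;> simp [hp0 x]

variable {p : State K → ℝ}

/-- The flow between two successive levels of the total number of EVs. -/
theorem IsStationary.total_cut (hlam : 0 < lam) (hmu : 0 < mu) (hnu : 0 < nu) (hM : 0 < M)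
    (h : IsStationary lam mu nu M K p) (n : ℕ) :
    mu * (n + 1) * marginal p (fun x => x.1.2) (n + 1) =
      (if ((n + 1 : ℕ) : ℕ∞) ≤ K then lam else 0) * marginal p (fun x => x.1.2) n := by
  -- Testing the generator on the indicator of `q ≤ n` leaves only the flow across the cut between
  -- `n` and `n + 1`.
  have h0 := h.hasSum_generator hlam hmu hnu hM (fun _ b => if b ≤ n then 1 else 0) <| by
    refine summable_of_hasFiniteSupport ((finite_total_le K n).subset fun x hx => ?_)
    simp only [Function.mem_support, ne_eq, mul_eq_zero, not_or] at hx
    by_contra hn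
    exact hx.2 (by rw [if_neg (show ¬ x.1.2 ≤ n from hn), abs_zero])
  have h1 := ((summable_indicator h.hasSum_one.summable h.nonneg
    fun x => x.1.2 = n + 1).hasSum.mul_left (mu * (n + 1))).sub
    ((summable_indicator h.hasSum_one.summable h.nonneg
    fun x => x.1.2 = n).hasSum.mul_left (if ((n + 1 : ℕ) : ℕ∞) ≤ K then lam else 0))
  refine sub_eq_zero.1 (h1.unique (h0.congr_fun fun x => ?_))
  simp only [generator, charged]
  rcases lt_trichotomy x.1.2 n with hx | hx | hx
  · rw [if_neg (show x.1.2 ≠ n + 1 by omega), if_neg (show x.1.2 ≠ n by omega),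
      if_pos (show x.1.2 + 1 ≤ n by omega), if_pos (show x.1.2 ≤ n by omega),
      if_pos (show x.1.2 - 1 ≤ n by omega)]
    simp
  · rw [if_neg (show x.1.2 ≠ n + 1 by omega), if_pos hx,
      if_neg (show ¬ x.1.2 + 1 ≤ n by omega), if_pos (show x.1.2 ≤ n by omega),
      if_pos (show x.1.2 - 1 ≤ n by omega), hx]
    split_ifs <;> ring
  · rw [if_neg (show x.1.2 ≠ n by omega), if_neg (show ¬ x.1.2 + 1 ≤ n by omega),
      if_neg (show ¬ x.1.2 ≤ n by omega)]
    by_cases hn : x.1.2 = n + 1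
    · rw [if_pos hn, if_pos (show x.1.2 - 1 ≤ n by omega), total, hn]
      push_cast
      simp only [sub_self, mul_zero, ite_self]
      ring
    · rw [if_neg hn, if_neg (show ¬ x.1.2 - 1 ≤ n by omega)]
      simp

theorem marginal_total_eq_zero {n : ℕ} (hn : ¬ (n : ℕ∞) ≤ K) :
    marginal p (fun x => x.1.2) n = 0 := by
  rw [marginal, tsum_congr (g := fun _ => (0 : ℝ)), tsum_zero]
  intro x
  rw [if_neg, mul_zero]
  rintro rfl
  exact hn x.2.2

/-- The total number of EVs has a truncated Poisson distribution. -/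
theorem IsStationary.marginal_total (hlam : 0 < lam) (hmu : 0 < mu) (hnu : 0 < nu) (hM : 0 < M)
    (h : IsStationary lam mu nu M K p) (n : ℕ) :
    marginal p (fun x => x.1.2) n = marginal p (fun x => x.1.2) 0 *
      (if (n : ℕ∞) ≤ K then (lam / mu) ^ n / n.factorial else 0) := by
  induction n with
  | zero => simp
  | succ n ih =>
    split_ifs with hn
    · have hc := h.total_cut hlam hmu hnu hM n
      have hn' : (n : ℕ∞) ≤ K := (Nat.cast_le.2 (Nat.le_succ n)).trans hn
      rw [if_pos hn, ih, if_pos hn'] at hc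
      have hpos : mu * ((n : ℝ) + 1) ≠ 0 := by positivity
      rw [← mul_right_inj' hpos, hc, Nat.factorial_succ, pow_succ]
      push_cast
      field_simp
    · rw [marginal_total_eq_zero hn, mul_zero]

theorem IsStationary.hasSum_marginal (h : IsStationary lam mu nu M K p) (φ : State K → ℕ) :
    HasSum (marginal p φ) 1 := by
  have := hasSum_marginal_mul (p := p) φ (fun _ => 1) (by simpa using h.hasSum_one.summable)
  simpa [h.hasSum_one.tsum_eq] using this

theorem IsStationary.le_marginal (h : IsStationary lam mu nu M K p) (φ : State K → ℕ)
    (x : State K) : p x ≤ marginal p φ (φ x) := by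
  have := (summable_indicator h.hasSum_one.summable h.nonneg fun y => φ y = φ x).le_tsum x
    fun y _ => mul_nonneg (h.nonneg y) (by split_ifs <;> norm_num)
  simpa [marginal] using this

/-- The normalizing factor is the probability of an empty lot, at most 1. Bounding it by 1 makes the
estimate uniform in `K` and `M`. -/
theorem IsStationary.le_poisson (hlam : 0 < lam) (hmu : 0 < mu) (hnu : 0 < nu) (hM : 0 < M)
    (h : IsStationary lam mu nu M K p) (x : State K) :
    p x ≤ (lam / mu) ^ x.1.2 / x.1.2.factorial := by
  refine (h.le_marginal (fun x => x.1.2) x).trans ?_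
  rw [h.marginal_total hlam hmu hnu hM, if_pos x.2.2]
  refine mul_le_of_le_one_left (by positivity) ?_
  exact le_hasSum (h.hasSum_marginal _) 0 fun n _ => marginal_nonneg h.nonneg _ n

/-- A summable bound for `p x * (1 + total x) ^ 2` that does not depend on the stationary
distribution `p`. -/
noncomputable def tailBound (a : ℝ) (z : ℕ × ℕ) : ℝ :=
  (1 / 2) ^ z.1 * ((8 * a) ^ z.2 / z.2.factorial)

theorem summable_tailBound {a : ℝ} (ha : 0 ≤ a) (K : ℕ∞) :
    Summable fun x : State K => tailBound a x.1 := by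
  have h : Summable (tailBound a) :=
    Summable.mul_of_nonneg (f := fun n : ℕ => (1 / 2 : ℝ) ^ n)
      (g := fun n : ℕ => (8 * a) ^ n / n.factorial) summable_geometric_two
      (Real.summable_pow_div_factorial _) (fun n => by positivity) (fun n => by positivity)
  exact h.comp_injective Subtype.val_injective

/-- The factor `(1 / 2) ^ u` secures summability over `u`. It costs `2 ^ q` because `u ≤ q`, and `(1
+ q) ^ 2 ≤ 4 ^ q`, whence the constant `8`. -/
theorem poisson_mul_le_tailBound {a : ℝ} (ha : 0 ≤ a) (x : State K) :
    a ^ x.1.2 / x.1.2.factorial * (1 + total x) ^ 2 ≤ tailBound a x.1 := by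
  obtain ⟨⟨u, q⟩, huq, -⟩ := x
  simp only [tailBound, total] at huq ⊢
  have h1 : (1 + (q : ℝ)) ≤ 2 ^ q := by
    have : 1 + q ≤ 2 ^ q := by have := Nat.lt_two_pow_self (n := q); omega
    exact_mod_cast this
  have h2 : (1 : ℝ) ≤ (1 / 2) ^ u * 2 ^ q := by
    obtain ⟨k, rfl⟩ := Nat.exists_eq_add_of_le huq
    rw [pow_add, ← mul_assoc, ← mul_pow]
    norm_num
    exact one_le_pow₀ (by norm_num)
  have h3 : (1 + (q : ℝ)) ^ 2 ≤ (1 / 2) ^ u * 8 ^ q := by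
    calc (1 + (q : ℝ)) ^ 2 ≤ 1 * (2 ^ q) ^ 2 := by
          rw [one_mul]; exact pow_le_pow_left₀ (by positivity) h1 2
      _ ≤ ((1 / 2) ^ u * 2 ^ q) * (2 ^ q) ^ 2 := by gcongr
      _ = (1 / 2) ^ u * 8 ^ q := by
          rw [show (8 : ℝ) = 2 * 2 * 2 by norm_num, mul_pow, mul_pow]; ring
  calc a ^ q / q.factorial * (1 + (q : ℝ)) ^ 2
      ≤ a ^ q / q.factorial * ((1 / 2) ^ u * 8 ^ q) := by gcongr
    _ = _ := by rw [mul_pow]; ring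

/-- Functions of at most quadratic growth are integrable in stationarity. -/
theorem IsStationary.summable_mul (hlam : 0 < lam) (hmu : 0 < mu) (hnu : 0 < nu) (hM : 0 < M)
    (h : IsStationary lam mu nu M K p) {f : State K → ℝ} (hf : ∀ x, |f x| ≤ (1 + total x) ^ 2) :
    Summable fun x => p x * f x := by
  have ha : 0 ≤ lam / mu := by positivity
  refine Summable.of_norm_bounded (summable_tailBound ha K) fun x => ?_
  refine le_trans ?_ (poisson_mul_le_tailBound ha x)
  rw [norm_mul, Real.norm_eq_abs, Real.norm_eq_abs, abs_of_nonneg (h.nonneg x)]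
  exact mul_le_mul (h.le_poisson hlam hmu hnu hM x) (hf x) (abs_nonneg _) (by positivity)

theorem IsStationary.unique (hlam : 0 < lam) (hmu : 0 < mu) (hnu : 0 < nu) (hM : 0 < M)
    (h : IsStationary lam mu nu M K p) {w : State K → ℝ} (hw : IsStationary lam mu nu M K w) :
    p = w := by
  have hr := locallyFiniteRates (K := K) hlam hmu hnu hM
  refine hr.stationary_unique (reaches hlam hmu hnu hM) h.nonneg hw.nonneg h.hasSum_one
    hw.hasSum_one h.balanced hw.balanced ?_
  refine ((h.summable_mul hlam hmu hnu hM (f := fun x => 1 + total x) fun x => ?_).mul_left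
    (lam + nu * M + mu)).of_nonneg_of_le
    (fun x => mul_nonneg (h.nonneg x) (hr.exit_nonneg x)) fun x => ?_
  · rw [abs_of_nonneg (by linarith [total_nonneg x])]
    nlinarith [total_nonneg x]
  · rw [mul_left_comm]
    exact mul_le_mul_of_nonneg_left (exit_rate_le hlam hmu hnu hM x) (h.nonneg x)

theorem exists_isStationary_nat (hlam : 0 < lam) (hmu : 0 < mu) (hnu : 0 < nu) (hM : 0 < M)
    (K : ℕ) : ∃ p : State (K : ℕ∞) → ℝ, IsStationary lam mu nu M K p := by
  have hfin : Finite (State (K : ℕ∞)) := by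
    refine Set.finite_univ_iff.1 ((finite_total_le K K).subset fun x _ => ?_)
    exact Nat.cast_le.1 x.2.2
  have := Fintype.ofFinite (State (K : ℕ∞))
  have : Nonempty (State (K : ℕ∞)) := ⟨⟨(0, 0), le_rfl, by simp⟩⟩
  obtain ⟨p, h0, h1, h2⟩ := (locallyFiniteRates (K := K) hlam hmu hnu hM).exists_stationary
  exact ⟨p, h0, h1, h2⟩

end Marginals

/-! ### Existence for infinitely many spaces -/

section Existence

open Filter Topology

variable {lam mu nu M : ℝ}

/-- The states of the lot with `N` spaces, as states of the infinite lot. -/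
def State.toTop {N : ℕ∞} (x : State N) : State ⊤ := ⟨x.1, x.2.1, le_top⟩

theorem State.toTop_injective {N : ℕ∞} : Function.Injective (State.toTop (N := N)) :=
  fun _ _ h => Subtype.ext (congrArg (fun y : State ⊤ => y.1) h)

theorem mem_range_toTop {N : ℕ∞} {x : State ⊤} :
    x ∈ Set.range (State.toTop (N := N)) ↔ (x.1.2 : ℕ∞) ≤ N :=
  ⟨by rintro ⟨y, rfl⟩; exact y.2.2, fun h => ⟨⟨x.1, x.2.1, h⟩, rfl⟩⟩

/-- Extension of a function by zero to the states of the infinite lot. -/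
noncomputable def extendZero {N : ℕ∞} (p : State N → ℝ) : State ⊤ → ℝ :=
  Function.extend State.toTop p 0

theorem extendZero_toTop {N : ℕ∞} (p : State N → ℝ) (x : State N) :
    extendZero p x.toTop = p x := State.toTop_injective.extend_apply _ _ _

theorem extendZero_of_not {N : ℕ∞} (p : State N → ℝ) {x : State ⊤} (hx : ¬ (x.1.2 : ℕ∞) ≤ N) :
    extendZero p x = 0 :=
  Function.extend_apply' _ _ _ fun h => hx (mem_range_toTop.1 h)

theorem tsum_extendZero_mul {N : ℕ∞} (p : State N → ℝ) (f : State ⊤ → ℝ) :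
    ∑' x, extendZero p x * f x = ∑' x, p x * f x.toTop := by
  have hsupp : (Function.support fun x => extendZero p x * f x) ⊆
      Set.range (State.toTop (N := N)) := fun x hx => by
    rw [mem_range_toTop]
    by_contra h
    exact hx (by simp only [extendZero_of_not p h, zero_mul])
  rw [← State.toTop_injective.tsum_eq hsupp]
  simp only [extendZero_toTop]

theorem rate_toTop {N : ℕ∞} (x y : State N) :
    rate lam mu nu M x.toTop y.toTop = rate lam mu nu M x y := rfl

/-- A full lot blocks arrivals, so the exit rates agree only strictly below capacity. -/
theorem exit_rate_toTop (hM : 0 < M) {N : ℕ∞} (y : State N) (hy : ((y.1.2 + 1 : ℕ) : ℕ∞) ≤ N) :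
    ∑' z, rate lam mu nu M y.toTop z = ∑' z, rate lam mu nu M y z := by
  rw [exit_rate hM, exit_rate hM, if_pos hy, if_pos le_top]
  rfl

/-- The infinite lot has a stationary distribution, a limit of those of finite lots. -/
theorem exists_isStationary_top (hlam : 0 < lam) (hmu : 0 < mu) (hnu : 0 < nu) (hM : 0 < M) :
    ∃ p : State ⊤ → ℝ, IsStationary lam mu nu M ⊤ p := by
  choose p hp using fun N => exists_isStationary_nat hlam hmu hnu hM N
  have hr := locallyFiniteRates (K := ⊤) hlam hmu hnu hM
  set e : ℕ → State ⊤ → ℝ := fun N => extendZero (p N) with he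
  have ha : 0 ≤ lam / mu := by positivity
  have he0 : ∀ N x, 0 ≤ e N x := fun N x => by
    by_cases hx : (x.1.2 : ℕ∞) ≤ (N : ℕ∞)
    · obtain ⟨y, rfl⟩ := mem_range_toTop.2 hx
      simpa only [he, extendZero_toTop] using (hp N).nonneg y
    · exact (extendZero_of_not _ hx).ge
  have heb : ∀ N x, e N x ≤ tailBound (lam / mu) x.1 := fun N x => by
    refine le_trans ?_ (poisson_mul_le_tailBound ha x)
    have h1 : (1 : ℝ) ≤ (1 + total x) ^ 2 := one_le_pow₀ (by linarith [total_nonneg x])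
    refine le_trans ?_ (le_mul_of_one_le_right (by positivity) h1)
    by_cases hx : (x.1.2 : ℕ∞) ≤ (N : ℕ∞)
    · obtain ⟨y, rfl⟩ := mem_range_toTop.2 hx
      simp only [he, extendZero_toTop]
      exact (hp N).le_poisson hlam hmu hnu hM y
    · refine (extendZero_of_not _ hx).le.trans ?_
      positivity
  -- A fixed nonprincipal ultrafilter gives limits at all states at once, replacing a diagonal
  -- subsequence.
  have hlim : ∀ x, ∃ c, Tendsto (fun N => e N x) (hyperfilter ℕ) (𝓝 c) := fun x => by
    obtain ⟨c, -, hc⟩ := (isCompact_Icc (a := (0 : ℝ)) 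
      (b := tailBound (lam / mu) x.1)).ultrafilter_le_nhds ((hyperfilter ℕ).map fun N => e N x)
      (by
        rw [Ultrafilter.coe_map, le_principal_iff, mem_map]
        exact univ_mem' fun N => ⟨he0 N x, heb N x⟩)
    exact ⟨c, hc⟩
  choose q hq using hlim
  have hnorm : ∀ N x, ‖e N x‖ ≤ tailBound (lam / mu) x.1 := fun N x => by
    rw [Real.norm_eq_abs, abs_of_nonneg (he0 N x)]
    exact heb N x
  have hq0 : ∀ x, 0 ≤ q x := fun x => ge_of_tendsto' (hq x) fun N => he0 N x
  have hqs : Summable q := (summable_tailBound ha ⊤).of_nonneg_of_le hq0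
    fun x => le_of_tendsto' (hq x) fun N => heb N x
  refine ⟨q, hq0, ?_, fun y => ?_⟩
  -- Domination by the summable tail bound prevents mass from escaping to infinity.
  · have h1 := tendsto_tsum_of_dominated_convergence (summable_tailBound ha ⊤) hq
      (Eventually.of_forall hnorm)
    have h2 : ∀ N, ∑' x, e N x = 1 := fun N => by
      have := tsum_extendZero_mul (p N) fun _ => 1
      simpa [(hp N).hasSum_one.tsum_eq] using this
    simp only [h2] at h1
    rw [tendsto_nhds_unique tendsto_const_nhds h1]
    exact hqs.hasSum
  · have h1 : Tendsto (fun N => ∑' x, e N x * rate lam mu nu M x y) (hyperfilter ℕ)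
        (𝓝 (∑' x, q x * rate lam mu nu M x y)) := by
      refine tendsto_tsum_of_dominated_convergence
        (hr.summable_col (fun x => tailBound (lam / mu) x.1) y)
        (fun x => (hq x).mul_const _) (Eventually.of_forall fun N x => ?_)
      rw [norm_mul, Real.norm_of_nonneg (hr.nonneg x y)]
      exact mul_le_mul_of_nonneg_right (hnorm N x) (hr.nonneg x y)
    refine tendsto_nhds_unique (h1.congr' ?_) ((hq y).mul_const _)
    have hle : (hyperfilter ℕ : Filter ℕ) ≤ atTop :=
      Nat.cofinite_eq_atTop ▸ hyperfilter_le_cofinite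
    -- Once `N` exceeds the total at `y`, balance at `y` is the same equation in the lot with `N`
    -- spaces and in the infinite lot.
    refine Filter.Eventually.filter_mono hle ?_
    · filter_upwards [eventually_ge_atTop (y.1.2 + 1)] with N hN
      obtain ⟨z, rfl⟩ := mem_range_toTop (N := (N : ℕ∞)).2
        (Nat.cast_le.2 ((Nat.le_succ y.1.2).trans hN))
      rw [exit_rate_toTop hM z (Nat.cast_le.2 hN)]
      simp only [he, extendZero_toTop, tsum_extendZero_mul, rate_toTop]
      exact (hp N).balance z

end Existence

/-! ### Comparison of lots -/

section Comparison

variable {lam mu nu M : ℝ} {K : ℕ∞} {p : State K → ℝ}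

/-- The flow between two successive levels of the number of uncharged EVs. -/
theorem IsStationary.uncharged_cut (hlam : 0 < lam) (hmu : 0 < mu) (hnu : 0 < nu) (hM : 0 < M)
    (h : IsStationary lam mu nu M K p) (n : ℕ) :
    (nu * power M (n + 1) + mu * (n + 1)) * marginal p (fun x => x.1.1) (n + 1) =
      ∑' x : State K, p x * if x.1.1 = n ∧ ((x.1.2 + 1 : ℕ) : ℕ∞) ≤ K then lam else 0 := by
  -- The test function is now the indicator of `u ≤ n`. Upward crossings are unblocked arrivals, so
  -- `q` survives only through the blocking condition.
  have h0 := h.hasSum_generator hlam hmu hnu hM (fun a _ => if a ≤ n then 1 else 0) <| by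
    simp only [mul_assoc]
    refine h.summable_mul hlam hmu hnu hM fun x => ?_
    have hx := total_nonneg x
    rw [abs_mul, abs_abs, abs_of_nonneg (by linarith)]
    split_ifs
    · rw [abs_one]; nlinarith
    · rw [abs_zero]; nlinarith
  have h1 := (summable_indicator h.hasSum_one.summable h.nonneg
    fun x => x.1.1 = n + 1).hasSum.mul_left (nu * power M (n + 1) + mu * (n + 1))
  have h2 := (summable_indicator h.hasSum_one.summable h.nonneg
    fun x => x.1.1 = n ∧ ((x.1.2 + 1 : ℕ) : ℕ∞) ≤ K).mul_left lam
  have h3 : ∀ x : State K, lam * (p x * if x.1.1 = n ∧ ((x.1.2 + 1 : ℕ) : ℕ∞) ≤ K then 1 else 0) =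
      p x * if x.1.1 = n ∧ ((x.1.2 + 1 : ℕ) : ℕ∞) ≤ K then lam else 0 := fun x => by
    split_ifs <;> ring
  simp only [h3] at h2
  refine sub_eq_zero.1 ((h1.sub h2.hasSum).unique (h0.congr_fun fun x => ?_))
  simp only [generator]
  rcases lt_trichotomy x.1.1 n with hx | hx | hx
  · rw [if_neg (show x.1.1 ≠ n + 1 by omega), if_neg (show ¬ (x.1.1 = n ∧ _) by omega),
      if_pos (show x.1.1 + 1 ≤ n by omega), if_pos (show x.1.1 ≤ n by omega),
      if_pos (show x.1.1 - 1 ≤ n by omega)]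
    simp
  · rw [if_neg (show x.1.1 ≠ n + 1 by omega),
      if_neg (show ¬ x.1.1 + 1 ≤ n by omega), if_pos (show x.1.1 ≤ n by omega),
      if_pos (show x.1.1 - 1 ≤ n by omega)]
    simp only [hx, true_and]
    split_ifs <;> ring
  · rw [if_neg (show ¬ (x.1.1 = n ∧ _) by omega), if_neg (show ¬ x.1.1 + 1 ≤ n by omega),
      if_neg (show ¬ x.1.1 ≤ n by omega)]
    by_cases hn : x.1.1 = n + 1
    · rw [if_pos hn, if_pos (show x.1.1 - 1 ≤ n by omega), uncharged, hn]
      push_cast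
      simp only [sub_self, mul_zero, ite_self]
      ring
    · rw [if_neg hn, if_neg (show ¬ x.1.1 - 1 ≤ n by omega)]
      simp

theorem IsStationary.uncharged_cut_le (hlam : 0 < lam) (hmu : 0 < mu) (hnu : 0 < nu) (hM : 0 < M)
    (h : IsStationary lam mu nu M K p) (n : ℕ) :
    (nu * power M (n + 1) + mu * (n + 1)) * marginal p (fun x => x.1.1) (n + 1) ≤
      lam * marginal p (fun x => x.1.1) n := by
  rw [h.uncharged_cut hlam hmu hnu hM, marginal]
  have h2 := (summable_indicator h.hasSum_one.summable h.nonneg fun x => x.1.1 = n).mul_left lam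
  rw [← tsum_mul_left]
  have hle : ∀ x : State K, (p x * if x.1.1 = n ∧ ((x.1.2 + 1 : ℕ) : ℕ∞) ≤ K then lam else 0) ≤
      lam * (p x * if x.1.1 = n then 1 else 0) := fun x => by
    have h1 := mul_nonneg hlam.le (h.nonneg x)
    by_cases hn : x.1.1 = n
    · simp only [hn, true_and, if_true]
      split_ifs <;> linarith
    · simp [hn]
  refine Summable.tsum_le_tsum hle (h2.of_nonneg_of_le (fun x => mul_nonneg (h.nonneg x) ?_) hle) h2
  split_ifs <;> linarith

theorem IsStationary.uncharged_cut_top (hlam : 0 < lam) (hmu : 0 < mu) (hnu : 0 < nu) (hM : 0 < M)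
    {p : State ⊤ → ℝ} (h : IsStationary lam mu nu M ⊤ p) (n : ℕ) :
    (nu * power M (n + 1) + mu * (n + 1)) * marginal p (fun x => x.1.1) (n + 1) =
      lam * marginal p (fun x => x.1.1) n := by
  rw [h.uncharged_cut hlam hmu hnu hM, marginal, ← tsum_mul_left]
  refine tsum_congr fun x => ?_
  simp only [le_top, and_true]
  split_ifs <;> ring

theorem IsStationary.summable_uncharged (hlam : 0 < lam) (hmu : 0 < mu) (hnu : 0 < nu)
    (hM : 0 < M) (h : IsStationary lam mu nu M K p) : Summable fun x => p x * uncharged x :=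
  h.summable_mul hlam hmu hnu hM fun x => by
    have h1 := uncharged_nonneg x
    have h2 := charged_nonneg x
    rw [charged] at h2
    rw [abs_of_nonneg h1]
    nlinarith

theorem IsStationary.summable_total (hlam : 0 < lam) (hmu : 0 < mu) (hnu : 0 < nu)
    (hM : 0 < M) (h : IsStationary lam mu nu M K p) : Summable fun x => p x * total x :=
  h.summable_mul hlam hmu hnu hM fun x => by
    have h1 := total_nonneg x
    rw [abs_of_nonneg h1]
    nlinarith

theorem IsStationary.summable_charged (hlam : 0 < lam) (hmu : 0 < mu) (hnu : 0 < nu)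
    (hM : 0 < M) (h : IsStationary lam mu nu M K p) : Summable fun x => p x * charged x := by
  simpa only [charged, mul_sub] using
    (h.summable_total hlam hmu hnu hM).sub (h.summable_uncharged hlam hmu hnu hM)

theorem IsStationary.summable_power (hlam : 0 < lam) (hmu : 0 < mu) (hnu : 0 < nu)
    (hM : 0 < M) (h : IsStationary lam mu nu M K p) :
    Summable fun x => p x * power M (uncharged x) :=
  (h.summable_uncharged hlam hmu hnu hM).of_nonneg_of_le
    (fun x => mul_nonneg (h.nonneg x) (power_nonneg hM (uncharged_nonneg x)))
    fun x => mul_le_mul_of_nonneg_left (min_le_left _ _) (h.nonneg x)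

theorem IsStationary.expectation_total (hlam : 0 < lam) (hmu : 0 < mu) (hnu : 0 < nu)
    (hM : 0 < M) (h : IsStationary lam mu nu M K p) :
    expectation p total = expectation p uncharged + expectation p charged := by
  rw [expectation, expectation, expectation, ← (h.summable_uncharged hlam hmu hnu hM).tsum_add
    (h.summable_charged hlam hmu hnu hM)]
  refine tsum_congr fun x => ?_
  rw [charged]
  ring

/-- In stationarity EVs become charged at the rate at which charged EVs leave. -/
theorem IsStationary.expectation_charged (hlam : 0 < lam) (hmu : 0 < mu) (hnu : 0 < nu)
    (hM : 0 < M) (h : IsStationary lam mu nu M K p) :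
    mu * expectation p charged = nu * expectation p fun x => power M (uncharged x) := by
  -- The test function is the number of charged EVs, which arrivals and departures of uncharged EVs
  -- leave unchanged.
  have h0 := h.hasSum_generator hlam hmu hnu hM (fun a b => (b : ℝ) - a) <| by
    simp only [mul_assoc]
    refine h.summable_mul hlam hmu hnu hM fun x => ?_
    have h1 := uncharged_nonneg x
    have h2 := charged_nonneg x
    have h3 := total_nonneg x
    rw [abs_mul, abs_abs, abs_of_nonneg (by linarith)]
    change (1 + total x) * |charged x| ≤ _
    rw [abs_of_nonneg h2]
    rw [charged] at h2 ⊢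
    nlinarith
  have h1 := ((h.summable_power hlam hmu hnu hM).hasSum.mul_left nu).sub
    ((h.summable_charged hlam hmu hnu hM).hasSum.mul_left mu)
  refine (sub_eq_zero.1 (h1.unique (h0.congr_fun fun x => ?_))).symm
  obtain ⟨⟨u, q⟩, huq, hqK⟩ := x
  simp only [generator, uncharged, charged, total] at huq ⊢
  rcases Nat.eq_zero_or_pos u with rfl | hu
  · rcases Nat.eq_zero_or_pos q with rfl | hq
    · simp [power_zero hM]
    · obtain ⟨q, rfl⟩ := Nat.exists_eq_succ_of_ne_zero hq.ne'
      simp [power_zero hM]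
      ring
  · obtain ⟨u, rfl⟩ := Nat.exists_eq_succ_of_ne_zero hu.ne'
    obtain ⟨q, rfl⟩ := Nat.exists_eq_succ_of_ne_zero (hu.trans_le huq).ne'
    simp only [Nat.succ_eq_add_one, Nat.add_sub_cancel]
    push_cast
    split_ifs <;> ring

theorem IsStationary.expectation_total_pos (hlam : 0 < lam) (hmu : 0 < mu) (hnu : 0 < nu)
    (hM : 0 < M) (h : IsStationary lam mu nu M K p) (hK : 1 ≤ K) : 0 < expectation p total := by
  let x : State K := ⟨(0, 1), zero_le_one, by simpa using hK⟩
  -- By irreducibility, zero mass at one state would make `p` vanish identically.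
  have hx : p x ≠ 0 := fun h0 => by
    have hz : p = 0 := funext fun y => (locallyFiniteRates hlam hmu hnu hM).eq_zero_of_reaches
      h.nonneg h.balanced (reaches hlam hmu hnu hM y x) h0
    have h1 := h.hasSum_one
    rw [hz] at h1
    exact zero_ne_one (hasSum_zero.unique h1)
  exact (h.summable_total hlam hmu hnu hM).tsum_pos
    (fun y => mul_nonneg (h.nonneg y) (total_nonneg y)) x
    (mul_pos ((h.nonneg x).lt_of_ne' hx) (by simp [total, x]))

/-- The mean number of EVs does not depend on the power level. -/
theorem IsStationary.expectation_total_eq (hlam : 0 < lam) (hmu : 0 < mu) (hnu : 0 < nu)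
    (hM : 0 < M) (h : IsStationary lam mu nu M K p) {M' : ℝ} (hM' : 0 < M') {w : State K → ℝ}
    (hw : IsStationary lam mu nu M' K w) : expectation p total = expectation w total := by
  have hp1 := (h.hasSum_marginal fun x => x.1.2).tsum_eq
  have hw1 := (hw.hasSum_marginal fun x => x.1.2).tsum_eq
  rw [tsum_congr (h.marginal_total hlam hmu hnu hM), tsum_mul_left] at hp1
  rw [tsum_congr (hw.marginal_total hlam hmu hnu hM'), tsum_mul_left] at hw1
  -- Both empty-lot probabilities are the inverse of the same Poisson sum.
  have h0 := mul_right_cancel₀ (right_ne_zero_of_mul_eq_one hp1) (hp1.trans hw1.symm)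
  have hp2 := hasSum_marginal_mul (p := p) (fun x => x.1.2) (fun n => (n : ℝ))
    (h.summable_total hlam hmu hnu hM)
  have hw2 := hasSum_marginal_mul (p := w) (fun x => x.1.2) (fun n => (n : ℝ))
    (hw.summable_total hlam hmu hnu hM')
  refine hp2.unique (hw2.congr_fun fun n => ?_)
  rw [h.marginal_total hlam hmu hnu hM, hw.marginal_total hlam hmu hnu hM', h0]

/-- Each successive ratio of `P` is at most `lam / d n`, the one of `Q`; the steps multiply along
the induction, cross-multiplied to allow zeros. -/
theorem likelihood_ratio_of_rates {P Q d : ℕ → ℝ} (hlam : 0 < lam) (hd : ∀ n, 0 < d n)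
    (hQ0 : ∀ n, 0 ≤ Q n) (hP : ∀ n, d n * P (n + 1) ≤ lam * P n)
    (hQ : ∀ n, d n * Q (n + 1) = lam * Q n) {u v : ℕ} (huv : u ≤ v) : P v * Q u ≤ P u * Q v := by
  induction v, huv using Nat.le_induction with
  | base => exact le_rfl
  | succ v _ ih =>
    refine le_of_mul_le_mul_left ?_ (hd v)
    calc d v * (P (v + 1) * Q u) = d v * P (v + 1) * Q u := by ring
      _ ≤ lam * P v * Q u := mul_le_mul_of_nonneg_right (hP v) (hQ0 u)
      _ = lam * (P v * Q u) := by ring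
      _ ≤ lam * (P u * Q v) := mul_le_mul_of_nonneg_left ih hlam.le
      _ = P u * (lam * Q v) := by ring
      _ = d v * (P u * Q (v + 1)) := by rw [← hQ v]; ring

/-- Ratios of means of two functions with increasing quotient are monotone in the likelihood
ratio order. -/
theorem tsum_mul_tsum_le_of_likelihood_ratio {P Q a b : ℕ → ℝ}
    (hP : ∀ n, 0 ≤ P n) (hQ : ∀ n, 0 ≤ Q n) (ha : ∀ n, 0 ≤ a n) (hb : ∀ n, 0 ≤ b n)
    (hPa : Summable fun n => P n * a n) (hPb : Summable fun n => P n * b n)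
    (hQa : Summable fun n => Q n * a n) (hQb : Summable fun n => Q n * b n)
    (hPQ : ∀ u v, u ≤ v → P v * Q u ≤ P u * Q v) (hab : ∀ u v, u ≤ v → a u * b v ≤ a v * b u) :
    (∑' n, P n * a n) * (∑' n, Q n * b n) ≤ (∑' n, P n * b n) * (∑' n, Q n * a n) := by
  have h1 := hPb.hasSum.mul hQa.hasSum (hPb.mul_of_nonneg hQa
    (fun n => mul_nonneg (hP n) (hb n)) fun n => mul_nonneg (hQ n) (ha n))
  have h2 := hPa.hasSum.mul hQb.hasSum (hPa.mul_of_nonneg hQb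
    (fun n => mul_nonneg (hP n) (ha n)) fun n => mul_nonneg (hQ n) (hb n))
  have h3 := h1.sub h2
  -- Adding the swapped sum makes each term `(P u * Q v - P v * Q u) * (a v * b u - a u * b v)`,
  -- whose factors have the same sign.
  have h4 := h3.add ((Equiv.prodComm ℕ ℕ).hasSum_iff.2 h3)
  have h5 := h4.nonneg fun z => ?_
  · linarith
  · obtain ⟨u, v⟩ := z
    simp only [Function.comp, Equiv.prodComm_apply, Prod.swap]
    have key : 0 ≤ (P u * Q v - P v * Q u) * (a v * b u - a u * b v) := by
      rcases le_total u v with h | h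
      · exact mul_nonneg (sub_nonneg.2 (hPQ u v h)) (sub_nonneg.2 (hab u v h))
      · exact mul_nonneg_of_nonpos_of_nonpos (sub_nonpos.2 (by linarith [hPQ v u h]))
          (sub_nonpos.2 (by linarith [hab v u h]))
    linarith

/-- The cross-multiplied form of `min(u, M) / u` being nonincreasing. -/
theorem mul_power_le_mul_power {u v : ℝ} (hM : 0 < M) (hu : 0 ≤ u) (huv : u ≤ v) :
    u * power M v ≤ v * power M u := by
  rw [power, power, mul_min_of_nonneg _ _ hu, mul_min_of_nonneg _ _ (hu.trans huv), mul_comm u v]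
  exact min_le_min_left _ (mul_le_mul_of_nonneg_right huv hM.le)

/-- Compared with infinitely many spaces, a finite number of spaces raises the mean power used
per uncharged EV. -/
theorem uncharged_mul_power_le (hlam : 0 < lam) (hmu : 0 < mu) (hnu : 0 < nu) (hM : 0 < M)
    (h : IsStationary lam mu nu M K p) {w : State ⊤ → ℝ} (hw : IsStationary lam mu nu M ⊤ w) :
    expectation p uncharged * expectation w (fun x => power M (uncharged x)) ≤
      expectation p (fun x => power M (uncharged x)) * expectation w uncharged := by
  have pa := hasSum_marginal_mul (p := p) (fun x => x.1.1) (fun n => (n : ℝ))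
    (h.summable_uncharged hlam hmu hnu hM)
  have pb := hasSum_marginal_mul (p := p) (fun x => x.1.1) (fun n => power M n)
    (h.summable_power hlam hmu hnu hM)
  have wa := hasSum_marginal_mul (p := w) (fun x => x.1.1) (fun n => (n : ℝ))
    (hw.summable_uncharged hlam hmu hnu hM)
  have wb := hasSum_marginal_mul (p := w) (fun x => x.1.1) (fun n => power M n)
    (hw.summable_power hlam hmu hnu hM)
  have key := tsum_mul_tsum_le_of_likelihood_ratio
    (marginal_nonneg h.nonneg fun x => x.1.1) (marginal_nonneg hw.nonneg fun x => x.1.1)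
    (fun n => Nat.cast_nonneg n) (fun n => power_nonneg hM (Nat.cast_nonneg n))
    pa.summable pb.summable wa.summable wb.summable
    (fun u v huv => likelihood_ratio_of_rates hlam
      (d := fun n => nu * power M (n + 1) + mu * (n + 1))
      (fun n => add_pos_of_nonneg_of_pos
        (mul_nonneg hnu.le (power_nonneg hM (by positivity))) (by positivity))
      (marginal_nonneg hw.nonneg fun x => x.1.1) (h.uncharged_cut_le hlam hmu hnu hM)
      (hw.uncharged_cut_top hlam hmu hnu hM) huv)
    (fun u v huv => mul_power_le_mul_power hM (Nat.cast_nonneg u) (Nat.cast_le.2 huv))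
  rw [pa.tsum_eq, pb.tsum_eq, wa.tsum_eq, wb.tsum_eq] at key
  exact key

theorem IsStationary.charged_le (hlam : 0 < lam) (hmu : 0 < mu) (hnu : 0 < nu) (hM : 0 < M)
    (h : IsStationary lam mu nu M K p) :
    (mu + nu) * expectation p charged ≤ nu * expectation p total := by
  have h1 := h.expectation_charged hlam hmu hnu hM
  have h2 := h.expectation_total hlam hmu hnu hM
  have h3 : expectation p (fun x => power M (uncharged x)) ≤ expectation p uncharged :=
    (h.summable_power hlam hmu hnu hM).tsum_le_tsum
      (fun x => mul_le_mul_of_nonneg_left (min_le_left _ _) (h.nonneg x))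
      (h.summable_uncharged hlam hmu hnu hM)
  nlinarith

/-- With `U ≤ K ≤ M` the power cap never binds, so the inequality of `charged_le` is attained. -/
theorem IsStationary.charged_eq_of_le {K : ℕ} {p : State (K : ℕ∞) → ℝ} (hlam : 0 < lam)
    (hmu : 0 < mu) (hnu : 0 < nu) (hM : 0 < M) (hK : (K : ℝ) ≤ M)
    (h : IsStationary lam mu nu M (K : ℕ∞) p) :
    (mu + nu) * expectation p charged = nu * expectation p total := by
  have h1 := h.expectation_charged hlam hmu hnu hM
  have h2 := h.expectation_total hlam hmu hnu hM
  have h3 : (fun x : State (K : ℕ∞) => power M (uncharged x)) = uncharged := funext fun x =>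
    min_eq_left ((Nat.cast_le.2 (x.2.1.trans (Nat.cast_le.1 x.2.2))).trans hK)
  rw [h3] at h1
  linear_combination h1 - nu * h2

end Comparison

end ParkingLot

theorem mainTheorem1 (lam mu nu M : ℝ) (K : ℕ)
    (hlam : 0 < lam) (hmu : 0 < mu) (hnu : 0 < nu) (hM : 0 < M) (hMK : M ≤ (K : ℝ)) :
    (∃! p : ParkingLot.State ⊤ → ℝ, ParkingLot.IsStationary lam mu nu M ⊤ p) ∧
    (∃! p : ParkingLot.State (K : ℕ∞) → ℝ,
      ParkingLot.IsStationary lam mu nu M (K : ℕ∞) p) ∧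
    (∃! p : ParkingLot.State (K : ℕ∞) → ℝ,
      ParkingLot.IsStationary lam mu nu (K : ℝ) (K : ℕ∞) p) ∧
    ∀ (pInf : ParkingLot.State ⊤ → ℝ) (pM pK : ParkingLot.State (K : ℕ∞) → ℝ),
      ParkingLot.IsStationary lam mu nu M ⊤ pInf →
      ParkingLot.IsStationary lam mu nu M (K : ℕ∞) pM →
      ParkingLot.IsStationary lam mu nu (K : ℝ) (K : ℕ∞) pK →
      Summable (fun x => pInf x * ParkingLot.charged x) ∧
      Summable (fun x => pInf x * ParkingLot.total x) ∧
      Summable (fun x => pM x * ParkingLot.charged x) ∧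
      Summable (fun x => pM x * ParkingLot.total x) ∧
      Summable (fun x => pK x * ParkingLot.charged x) ∧
      0 < ParkingLot.expectation pInf ParkingLot.total ∧
      0 < ParkingLot.expectation pM ParkingLot.total ∧
      ParkingLot.expectation pInf ParkingLot.charged /
          ParkingLot.expectation pInf ParkingLot.total ≤
        ParkingLot.expectation pM ParkingLot.charged /
          ParkingLot.expectation pM ParkingLot.total ∧
      ParkingLot.expectation pM ParkingLot.charged /
          ParkingLot.expectation pM ParkingLot.total ≤
        ParkingLot.expectation pK ParkingLot.charged /
          ParkingLot.expectation pM ParkingLot.total := by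
  have hK0 : (0 : ℝ) < K := hM.trans_le hMK
  have hK1 : (1 : ℕ∞) ≤ (K : ℕ∞) := by
    exact_mod_cast Nat.one_le_iff_ne_zero.2 (Nat.cast_pos.1 hK0).ne'
  obtain ⟨a, ha⟩ := ParkingLot.exists_isStationary_top hlam hmu hnu hM
  obtain ⟨b, hb⟩ := ParkingLot.exists_isStationary_nat hlam hmu hnu hM K
  obtain ⟨c, hc⟩ := ParkingLot.exists_isStationary_nat hlam hmu hnu hK0 K
  refine ⟨⟨a, ha, fun w hw => hw.unique hlam hmu hnu hM ha⟩,
    ⟨b, hb, fun w hw => hw.unique hlam hmu hnu hM hb⟩,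
    ⟨c, hc, fun w hw => hw.unique hlam hmu hnu hK0 hc⟩, fun pInf pM pK hInf hpM hpK => ?_⟩
  have posInf := hInf.expectation_total_pos hlam hmu hnu hM le_top
  have posM := hpM.expectation_total_pos hlam hmu hnu hM hK1
  refine ⟨hInf.summable_charged hlam hmu hnu hM, hInf.summable_total hlam hmu hnu hM,
    hpM.summable_charged hlam hmu hnu hM, hpM.summable_total hlam hmu hnu hM,
    hpK.summable_charged hlam hmu hnu hK0, posInf, posM, ?_, ?_⟩
  · rw [div_le_div_iff₀ posInf posM, hInf.expectation_total hlam hmu hnu hM,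
      hpM.expectation_total hlam hmu hnu hM]
    have h1 := hInf.expectation_charged hlam hmu hnu hM
    have h2 := hpM.expectation_charged hlam hmu hnu hM
    have h3 := mul_le_mul_of_nonneg_left
      (ParkingLot.uncharged_mul_power_le hlam hmu hnu hM hpM hInf) hnu.le
    -- The product of the two means of `C` cancels; the factor `mu` lets each remaining mean of `C`
    -- be replaced by `nu` times a mean power.
    refine le_of_mul_le_mul_left ?_ hmu
    linear_combination h3 + ParkingLot.expectation pM ParkingLot.uncharged * h1 -
      ParkingLot.expectation pInf ParkingLot.uncharged * h2
  · refine div_le_div_of_nonneg_right ?_ posM.le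
    refine le_of_mul_le_mul_left ?_ (add_pos hmu hnu)
    -- Full power attains the bound `nu * E[Q]`, and `E[Q]` is the same at both power levels.
    rw [hpK.charged_eq_of_le hlam hmu hnu hK0 le_rfl,
      ← hpM.expectation_total_eq hlam hmu hnu hM hK0 hpK]
    exact hpM.charged_le hlam hmu hnu hM
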